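/- All digraphs are finite and may have parallel arcs. For a digraph $D=(V,A)$ and $U\subseteq V$, let $\delta^+(U)$ and $\delta^-(U)$ be the sets of arcs leaving and entering $U$, let $\delta(v)$ be the set of arcs incident with the node $v$, write $\delta^+(u)=\delta^+(\{u\})$, and for $x\in\mathbb R^A$ and $B\subseteq A$ let $x(B)=\sum_{a\in B}x_a$. A dicut is a set $\delta^+(U)$ with $\emptyset\ne U\subsetneq V$ and $\delta^-(U)=\emptyset$. The dijoin polyhedron is $$\mathrm{dij}(D)=\{x\in\mathbb R^A: x(\delta^+(U))\ge 1\text{ for every dicut }\delta^+(U),\ x\ge 0\}.$$ A *digraft* is a pair $(D=(V,A),\mathcal F)$ in which every node of $D$ is a source or a sink, the underlying undirected graph of $D$ is $2$-edge-connected, and $\mathcal F$ is a family of subsets of $V$ such that $\emptyset,V\notin\mathcal F$, $\delta^-(U)=\emptyset$ for all $U\in\mathcal F$, $V\setminus\{v\}\in\mathcal F$ for every sink $v$, and $$F(D,\mathcal F)=\mathrm{dij}(D)\cap\{x: x(\delta^+(U))=1\ \ \forall\, U\in\mathcal F\}$$ is nonempty. A dicut $\delta^+(U)$ is *tight* if $x(\delta^+(U))=1$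 for all $x\in F(D,\mathcal F)$. A node $v$ is *tight* if $x(\delta(v))=1$ for all $x\in F(D,\mathcal F)$, and *active* otherwise; $V^t$ is the set of tight nodes. The digraft is *basic* if every tight dicut $\delta^+(U)$ satisfies $U\in\mathcal F$ and $|U|\in\{1,|V|-1\}$. An inequality is *facet-defining* for $F(D,\mathcal F)$ if it is valid for $F(D,\mathcal F)$ and the points of $F(D,\mathcal F)$ that satisfy it with equality form a nonempty face of dimension $\dim F(D,\mathcal F)-1$; two inequalities are *equivalent* if they define the same face of $F(D,\mathcal F)$. A basic digraft is *robust* if every facet-defining inequality for $F(D,\mathcal F)$ is equivalent to $x_a\ge 0$ for some $a\in A$ or to $x(\delta^+(u))\ge 1$ for some source $u$. A digraft is *affine critical* if the affine hull of $F(D,\mathcal F)$ is $\{x: x(\delta(v))=1\ \ \forall\, v\in V^t\}$. Its *slack* is $|A|-|V^t|+\kappa^t-\dim F(D,\mathcal F)$, where $\kappa^t=1$ if $V^t=V$ and $\kappa^t=0$ otherwise. A dicut $\delta^+(U)$ is *contractible* if $1<|U|<|V|-1$ and $F(D,\mathcal F)\cap\{x:x(\delta^+(U))=1\}\neq\emptyset$.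 In that case let $U_1=U$ and $U_2=V\setminus U$, and let $\overline{\mathcal F}$ be the family of all $W$ with $\emptyset\neq W\subsetneq V$, $\delta^-(W)=\emptyset$ and $x(\delta^+(W))=1$ for all $x\in F(D,\mathcal F\cup\{U\})$. The $(U,V\setminus U)$-*contractions* of $(D,\mathcal F)$ are the pairs $(D_i,\mathcal F_i)$, $i=1,2$, where $D_i$ is obtained from $D$ by shrinking $U_i$ to a single node $u_i$ (so its node set is $U_{3-i}\cup\{u_i\}$, and its arcs are the arcs of $D$ that do not lie inside $U_i$) and $$\mathcal F_i=\{W: W\in\overline{\mathcal F},\ W\cap U_i=\emptyset\}\cup\{(W\setminus U_i)\cup\{u_i\}: W\in\overline{\mathcal F},\ U_i\subseteq W\}.$$ **Lemma (Affine Critical Lemma).** Let $(D=(V,A),\mathcal F)$ be a basic digraft that is not robust. Let $\delta^+(U)$ be a dicut such that $x(\delta^+(U))\ge 1$ is facet-defining for $F(D,\mathcal F)$ and is not equivalent to $x(\delta^+(u))\ge 1$ for any active source $u$ of $(D,\mathcal F)$. Then $\delta^+(U)$ is contractible, and $(D,\mathcal F)$ and both of its $(U,V\setminus U)$-contractions $(D_1,\mathcal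 F_1)$, $(D_2,\mathcal F_2)$ are affine critical digrafts, have slack zero, and contain at least one active source each. Furthermore, for $i\in\{1,2\}$, the active sources of $(D_i,\mathcal F_i)$ are exactly the active sources of $(D,\mathcal F)$ that lie in $U_{3-i}$; in particular $u_i$ is not active. -/

import Mathlib

/-- A directed multigraph on the node type `V` with arc type `A`; parallel arcs are allowed. -/
structure MultiDigraph (V A : Type*) where
  tail : A → V
  head : A → V

/-- The `0/1` indicator vector of a set `B` of arcs. -/
noncomputable def indVec {A : Type*} (B : Set A) : A → ℝ := B.indicator 1

/-- `x(B)`, the sum of the entries of `x` over `B`. -/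
noncomputable def arcSum {A : Type*} [Fintype A] (x : A → ℝ) (B : Set A) : ℝ := indVec B ⬝ᵥ x

/-- The face of `P` obtained by setting the inequality `c ⬝ᵥ x ≥ β` to equality. -/
def faceOf {A : Type*} [Fintype A] (P : Set (A → ℝ)) (c : A → ℝ) (β : ℝ) : Set (A → ℝ) :=
  {x | x ∈ P ∧ c ⬝ᵥ x = β}

/-- The dimension of the affine hull of a (nonempty) set. -/
noncomputable def affDim {A : Type*} (P : Set (A → ℝ)) : ℕ := Module.finrank ℝ (vectorSpan ℝ P)

/-- The inequality `c ⬝ᵥ x ≥ β` is facet-defining for `P`: it is valid for `P`, and the points of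
`P` at equality form a (nonempty) face whose dimension is one less than that of `P`. -/
def FacetDefining {A : Type*} [Fintype A] (P : Set (A → ℝ)) (c : A → ℝ) (β : ℝ) : Prop :=
  (∀ x ∈ P, β ≤ c ⬝ᵥ x) ∧ (faceOf P c β).Nonempty ∧ affDim (faceOf P c β) + 1 = affDim P

/-- Two inequalities `c ⬝ᵥ x ≥ β` and `c' ⬝ᵥ x ≥ β'` are equivalent for `P`: they define the same
face of `P`. -/
def EquivIneq {A : Type*} [Fintype A] (P : Set (A → ℝ)) (c : A → ℝ) (β : ℝ)
    (c' : A → ℝ) (β' : ℝ) : Prop :=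
  faceOf P c β = faceOf P c' β'

namespace MultiDigraph

variable {V A : Type*}

/-- `δ⁺(U)`, the arcs leaving `U`. -/
def outCut (D : MultiDigraph V A) (U : Set V) : Set A := {a | D.tail a ∈ U ∧ D.head a ∉ U}

/-- `δ⁻(U)`, the arcs entering `U`. -/
def inCut (D : MultiDigraph V A) (U : Set V) : Set A := {a | D.tail a ∉ U ∧ D.head a ∈ U}

/-- `δ(v)`, the arcs incident with the node `v`. -/
def star (D : MultiDigraph V A) (v : V) : Set A := {a | D.tail a = v ∨ D.head a = v}

/-- A source is a node with no incoming arc. -/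
def IsSource (D : MultiDigraph V A) (v : V) : Prop := ∀ a, D.head a ≠ v

/-- A sink is a node with no outgoing arc. -/
def IsSink (D : MultiDigraph V A) (v : V) : Prop := ∀ a, D.tail a ≠ v

/-- A digraph is bipartite if every node is a source or a sink. -/
def IsBipartite (D : MultiDigraph V A) : Prop := ∀ v, D.IsSource v ∨ D.IsSink v

/-- The underlying undirected graph is `2`-edge-connected: every cut has at least two edges. -/
def IsTwoEdgeConnected (D : MultiDigraph V A) : Prop :=
  Nonempty V ∧ ∀ U : Set V, U.Nonempty → U ≠ Set.univ → 2 ≤ (D.outCut U ∪ D.inCut U).ncard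

/-- `δ⁺(U)` is a dicut, with shore `U`: `U` is a nonempty proper node set without incoming arc. -/
def IsDicut (D : MultiDigraph V A) (U : Set V) : Prop :=
  U.Nonempty ∧ U ≠ Set.univ ∧ D.inCut U = ∅

/-- The dijoin polyhedron. -/
def dij [Fintype A] (D : MultiDigraph V A) : Set (A → ℝ) :=
  {x | (∀ U, D.IsDicut U → 1 ≤ arcSum x (D.outCut U)) ∧ ∀ a, 0 ≤ x a}

/-- The face `F(D, 𝓕)` of the dijoin polyhedron. -/
def face [Fintype A] (D : MultiDigraph V A) (𝓕 : Set (Set V)) : Set (A → ℝ) :=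
  D.dij ∩ {x | ∀ U ∈ 𝓕, arcSum x (D.outCut U) = 1}

/-- The pair `(D, 𝓕)` is a digraft. -/
structure IsDigraft [Fintype A] (D : MultiDigraph V A) (𝓕 : Set (Set V)) : Prop where
  bipartite : D.IsBipartite
  twoEdgeConnected : D.IsTwoEdgeConnected
  empty_notMem : ∅ ∉ 𝓕
  univ_notMem : Set.univ ∉ 𝓕
  inCut_eq_empty : ∀ U ∈ 𝓕, D.inCut U = ∅
  compl_sink_mem : ∀ v, D.IsSink v → {v}ᶜ ∈ 𝓕
  face_nonempty : (D.face 𝓕).Nonempty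

/-- The dicut `δ⁺(U)` is tight for `(D, 𝓕)`. -/
def IsTightDicut [Fintype A] (D : MultiDigraph V A) (𝓕 : Set (Set V)) (U : Set V) : Prop :=
  D.IsDicut U ∧ D.face 𝓕 ⊆ {x | arcSum x (D.outCut U) = 1}

/-- The pair `(D, 𝓕)` is a basic digraft. -/
def IsBasic [Fintype A] (D : MultiDigraph V A) (𝓕 : Set (Set V)) : Prop :=
  D.IsDigraft 𝓕 ∧ ∀ U, D.IsTightDicut 𝓕 U → U ∈ 𝓕 ∧ (U.ncard = 1 ∨ U.ncard + 1 = Nat.card V)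

/-- The pair `(D, 𝓕)` is a basic robust digraft: every facet-defining inequality is equivalent to
some `x_a ≥ 0`, or to `x(δ⁺(u)) ≥ 1` for some source `u`. -/
def IsRobust [Fintype A] (D : MultiDigraph V A) (𝓕 : Set (Set V)) : Prop :=
  D.IsBasic 𝓕 ∧ ∀ (c : A → ℝ) (β : ℝ), FacetDefining (D.face 𝓕) c β →
    (∃ a, EquivIneq (D.face 𝓕) c β (indVec {a}) 0) ∨
    (∃ u, D.IsSource u ∧ EquivIneq (D.face 𝓕) c β (indVec (D.outCut {u})) 1)

/-- The node `v` is tight for `(D, 𝓕)`; it is active if it is not tight. -/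
def IsTightNode [Fintype A] (D : MultiDigraph V A) (𝓕 : Set (Set V)) (v : V) : Prop :=
  D.face 𝓕 ⊆ {x | arcSum x (D.star v) = 1}

def IsActiveSource [Fintype A] (D : MultiDigraph V A) (𝓕 : Set (Set V)) (v : V) : Prop :=
  D.IsSource v ∧ ¬ D.IsTightNode 𝓕 v

/-- The pair `(D, 𝓕)` is an affine critical digraft: the affine hull of `F(D, 𝓕)` is described by
the equations `x(δ(v)) = 1` for the tight nodes `v`. -/
def IsAffineCritical [Fintype A] (D : MultiDigraph V A) (𝓕 : Set (Set V)) : Prop :=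
  D.IsDigraft 𝓕 ∧
    (affineSpan ℝ (D.face 𝓕) : Set (A → ℝ)) =
      {x | ∀ v, D.IsTightNode 𝓕 v → arcSum x (D.star v) = 1}

open scoped Classical in
/-- The slack `|A| - |Vᵗ| + κᵗ - dim F(D, 𝓕)`, where `Vᵗ` is the set of tight nodes and `κᵗ` is
`1` if all nodes are tight, and `0` otherwise. -/
noncomputable def slack [Fintype A] (D : MultiDigraph V A) (𝓕 : Set (Set V)) : ℤ :=
  (Fintype.card A : ℤ) - ({v | D.IsTightNode 𝓕 v} : Set V).ncard
    + (if ∀ v, D.IsTightNode 𝓕 v then 1 else 0) - affDim (D.face 𝓕)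

/-- The closure of `𝓕` for `(D, 𝓕)`: all shores of tight dicuts. -/
def closureFamily [Fintype A] (D : MultiDigraph V A) (𝓕 : Set (Set V)) : Set (Set V) :=
  {U | D.IsTightDicut 𝓕 U}

/-- The dicut `δ⁺(U)` is contractible for `(D, 𝓕)`. -/
def IsContractible [Fintype A] (D : MultiDigraph V A) (𝓕 : Set (Set V)) (U : Set V) : Prop :=
  D.IsDicut U ∧ 1 < U.ncard ∧ U.ncard + 1 < Nat.card V ∧
    (D.face 𝓕 ∩ {x | arcSum x (D.outCut U) = 1}).Nonempty

/-- The arcs that survive when `S` is shrunk to a single node: those not inside `S`. -/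
def ShrinkArc (D : MultiDigraph V A) (S : Set V) : Type _ :=
  {a : A // ¬ (D.tail a ∈ S ∧ D.head a ∈ S)}

noncomputable instance [Fintype A] (D : MultiDigraph V A) (S : Set V) : Fintype (D.ShrinkArc S) :=
  @Subtype.fintype A _ (fun _ => Classical.propDecidable _) _

/-- The nodes after shrinking `S`: `none` is the new node, and `some v` is the node `v ∉ S`. -/
abbrev ShrinkNode (S : Set V) : Type _ := Option ↥(Sᶜ)

open scoped Classical in
/-- The map that sends the nodes of `S` to the new node and fixes all others. -/
noncomputable def shrinkMap (S : Set V) (v : V) : ShrinkNode S :=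
  if h : v ∈ S then none else some ⟨v, h⟩

/-- The digraph obtained by shrinking `S` to a single node. -/
noncomputable def shrink (D : MultiDigraph V A) (S : Set V) :
    MultiDigraph (ShrinkNode S) (D.ShrinkArc S) where
  tail a := shrinkMap S (D.tail a.1)
  head a := shrinkMap S (D.head a.1)

/-- The set `W \ S`, as a set of nodes of the digraph in which `S` has been shrunk. -/
def keepSet (S W : Set V) : Set (ShrinkNode S) := some '' {v : ↥(Sᶜ) | (v : V) ∈ W}

/-- The family that goes with the shrinking of `S`, which is one of `U`, `V \ U`, in the
`(U, V \ U)`-contraction of `(D, 𝓕)`. -/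
def contractFamily [Fintype A] (D : MultiDigraph V A) (𝓕 : Set (Set V)) (U S : Set V) :
    Set (Set (ShrinkNode S)) :=
  {W' | ∃ W ∈ D.closureFamily (insert U 𝓕),
    (W ∩ S = ∅ ∧ W' = keepSet S W) ∨ (S ⊆ W ∧ W' = insert none (keepSet S W))}

end MultiDigraph

/-! ### Arc sums, and small perturbations of strict inequalities -/

section ArcSum

variable {A : Type*} [Fintype A]

/-! When no arc enters `W`, the value `x(δ⁺(W))` is the sum over `W` of the net outflow of `x`, and
net outflows sum to zero over all nodes. So dicut values depend only on the net vector, and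
circulations change none of them.

The face has a point that is positive on every arc and strict on every dicut that is not tight
(`exists_interior_mem_face`), so its directions are exactly the vectors vanishing on all tight
dicuts. If every tight dicut keeps the active nodes on one side (`Separated`), these equations
follow from those of the tight nodes. This gives affine criticality, and slack zero because the node
equations are independent once one node is left out. A basic digraft is trivially separated.

For the contractions, let `p` and `q` be active nodes on the same side of `U`. A unit flow from `p`
to `q` is a direction of the face and vanishes on `δ⁺(U)`; as the face of `U` is a facet, the flow
is a direction of that facet too. Hence no dicut tight on the facet separates `p` from `q`
(`IsBasic.mem_iff_mem`), so both contractions are separated. Active nodes stay active on the facet,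
since otherwise `U` would be equivalent to a single active source or some source would violate its
own inequality. -/

open scoped Classical in
theorem arcSum_eq_sum (x : A → ℝ) (B : Set A) : arcSum x B = ∑ a, if a ∈ B then x a else 0 := by
  simp [arcSum, indVec, dotProduct, Set.indicator_apply]

theorem arcSum_add (x y : A → ℝ) (B : Set A) : arcSum (x + y) B = arcSum x B + arcSum y B :=
  dotProduct_add _ _ _

theorem arcSum_sub (x y : A → ℝ) (B : Set A) : arcSum (x - y) B = arcSum x B - arcSum y B :=
  dotProduct_sub _ _ _

theorem arcSum_smul (t : ℝ) (x : A → ℝ) (B : Set A) : arcSum (t • x) B = t * arcSum x B :=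
  dotProduct_smul _ _ _

@[simp] theorem arcSum_empty (x : A → ℝ) : arcSum x ∅ = 0 := by simp [arcSum_eq_sum]

/-- `arcSum` over a fixed set, as a linear functional. -/
noncomputable def arcSumLin (B : Set A) : (A → ℝ) →ₗ[ℝ] ℝ where
  toFun x := arcSum x B
  map_add' x y := arcSum_add x y B
  map_smul' t x := arcSum_smul t x B

@[simp] theorem arcSumLin_apply (B : Set A) (x : A → ℝ) : arcSumLin B x = arcSum x B := rfl

theorem arcSum_eq_zero {x : A → ℝ} {B : Set A} (h : ∀ a ∈ B, x a = 0) : arcSum x B = 0 := by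
  classical
  rw [arcSum_eq_sum]
  refine Finset.sum_eq_zero fun a _ => ?_
  split_ifs with ha
  · exact h a ha
  · rfl

theorem arcSum_compl (x : A → ℝ) (B : Set A) : arcSum x Bᶜ = ∑ a, x a - arcSum x B := by
  classical
  rw [arcSum_eq_sum, arcSum_eq_sum, ← Finset.sum_sub_distrib]
  refine Finset.sum_congr rfl fun a _ => ?_
  by_cases ha : a ∈ B <;> simp [ha]

/-- A convex set on which each of finitely many strict linear inequalities is attained contains a
point attaining all of them. -/
theorem Convex.exists_forall_lt {E ι : Type*} [AddCommGroup E] [Module ℝ E] [Finite ι]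
    {P : Set E} (hP : Convex ℝ P) (hne : P.Nonempty) (g : ι → E →ₗ[ℝ] ℝ) (β : ι → ℝ)
    (hle : ∀ i, ∀ x ∈ P, β i ≤ g i x) (hlt : ∀ i, ∃ x ∈ P, β i < g i x) :
    ∃ x ∈ P, ∀ i, β i < g i x := by
  classical
  cases nonempty_fintype ι
  have key : ∀ s : Finset ι, ∃ x ∈ P, ∀ i ∈ s, β i < g i x := by
    intro s
    induction s using Finset.induction_on with
    | empty => obtain ⟨x, hx⟩ := hne; exact ⟨x, hx, by simp⟩
    | insert i s _ ih =>
      obtain ⟨x, hx, hxs⟩ := ih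
      obtain ⟨y, hy, hyi⟩ := hlt i
      refine ⟨(1 / 2 : ℝ) • x + (1 / 2 : ℝ) • y,
        hP hx hy (by norm_num) (by norm_num) (by norm_num), fun j hj => ?_⟩
      simp only [map_add, map_smul, smul_eq_mul]
      rcases Finset.mem_insert.1 hj with rfl | hj
      · linarith [hle j x hx]
      · linarith [hle j y hy, hxs j hj]
  obtain ⟨x, hx, h⟩ := key Finset.univ
  exact ⟨x, hx, fun i => h i (Finset.mem_univ i)⟩

theorem vectorSpan_le_ker {F E : Type*} [AddCommGroup F] [Module ℝ F]
    [AddCommGroup E] [Module ℝ E]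
    {P : Set F} (f : F →ₗ[ℝ] E) (h : ∀ x ∈ P, ∀ y ∈ P, f x = f y) :
    vectorSpan ℝ P ≤ LinearMap.ker f := by
  rw [vectorSpan_def, Submodule.span_le]
  rintro _ ⟨x, hx, y, hy, rfl⟩
  simp [h x hx y hy]

/-- Finitely many strict inequalities survive a small step in a given direction. -/
theorem exists_pos_forall_lt {ι : Type*} [Finite ι] (a b c : ι → ℝ) (h : ∀ i, c i < a i) :
    ∃ ε : ℝ, 0 < ε ∧ ∀ i, c i < a i + ε * b i := by
  have h1 : ∀ᶠ ε in nhdsWithin (0 : ℝ) (Set.Ioi 0), ∀ i, c i < a i + ε * b i := by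
    rw [Filter.eventually_all]
    intro i
    have : Filter.Tendsto (fun ε : ℝ => a i + ε * b i) (nhds 0) (nhds (a i + 0 * b i)) :=
      (Continuous.tendsto (by fun_prop) 0)
    exact ((this.mono_left nhdsWithin_le_nhds).eventually (lt_mem_nhds (by simpa using h i)))
  obtain ⟨ε, h2, h3⟩ := (h1.and self_mem_nhdsWithin).exists
  exact ⟨ε, h3, h2⟩

end ArcSum

namespace MultiDigraph

/-! ### Net outflow and dicut values -/

section Net

variable {V A : Type*} [Fintype A] (D : MultiDigraph V A)

open scoped Classical in
/-- The net outflow of a vector of arc values at each node. -/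
noncomputable def net : (A → ℝ) →ₗ[ℝ] (V → ℝ) :=
  Fintype.linearCombination ℝ fun a => Pi.single (D.tail a) (1 : ℝ) - Pi.single (D.head a) 1

open scoped Classical in
theorem net_apply (x : A → ℝ) (v : V) :
    D.net x v = ∑ a, x a * ((if D.tail a = v then 1 else 0) - if D.head a = v then 1 else 0) := by
  simp [net, Fintype.linearCombination_apply, Finset.sum_apply, Pi.single_apply, eq_comm]

variable [Fintype V]

theorem arcSum_net (x : A → ℝ) (W : Set V) :
    arcSum (D.net x) W = arcSum x (D.outCut W) - arcSum x (D.inCut W) := by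
  classical
  have h : ∀ v, (if v ∈ W then D.net x v else 0) = ∑ a, x a *
      ((if D.tail a = v then (if v ∈ W then 1 else 0) else 0) -
        if D.head a = v then (if v ∈ W then 1 else 0) else 0) := by
    intro v
    by_cases hv : v ∈ W <;> simp [hv, net_apply]
  rw [arcSum_eq_sum, Finset.sum_congr rfl fun v _ => h v, Finset.sum_comm, arcSum_eq_sum,
    arcSum_eq_sum, ← Finset.sum_sub_distrib]
  refine Finset.sum_congr rfl fun a _ => ?_
  rw [← Finset.mul_sum, Finset.sum_sub_distrib, Finset.sum_ite_eq, Finset.sum_ite_eq]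
  by_cases h1 : D.tail a ∈ W <;> by_cases h2 : D.head a ∈ W <;> simp [outCut, inCut, h1, h2]

theorem sum_net (x : A → ℝ) : ∑ v, D.net x v = 0 := by
  have := D.arcSum_net x Set.univ
  simpa [arcSum_eq_sum, outCut, inCut] using this

variable {D}

/-- Turns a dicut value into a sum over nodes; every later comparison of a dicut with the nodes on
one of its sides goes through this. -/
theorem arcSum_outCut {W : Set V} (hW : D.inCut W = ∅) (x : A → ℝ) :
    arcSum x (D.outCut W) = arcSum (D.net x) W := by
  rw [arcSum_net, hW, arcSum_empty, sub_zero]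

end Net
end MultiDigraph

namespace MultiDigraph

/-! ### Stars of sources and sinks -/

section Bip

variable {V A : Type*} {D : MultiDigraph V A}

theorem IsSource.outCut_singleton {v : V} (hv : D.IsSource v) : D.outCut {v} = D.star v := by
  ext a
  have := hv a
  simp only [outCut, star, Set.mem_singleton_iff, Set.mem_ofPred_eq]
  tauto

theorem IsSource.inCut_singleton {v : V} (hv : D.IsSource v) : D.inCut {v} = ∅ := by
  ext a
  have := hv a
  simp [inCut, this]

theorem IsSource.outCut_compl_singleton {v : V} (hv : D.IsSource v) : D.outCut {v}ᶜ = ∅ := by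
  ext a
  have := hv a
  simp [outCut, this]

theorem IsSink.outCut_compl_singleton {v : V} (hv : D.IsSink v) : D.outCut {v}ᶜ = D.star v := by
  ext a
  have := hv a
  simp [outCut, star, this]

theorem IsSink.inCut_compl_singleton {v : V} (hv : D.IsSink v) : D.inCut {v}ᶜ = ∅ := by
  ext a
  have := hv a
  simp [inCut, this]

theorem arcSum_singleton [Fintype V] (y : V → ℝ) (v : V) : arcSum y {v} = y v := by
  classical
  simp [arcSum_eq_sum]

variable [Fintype A]

theorem IsSource.arcSum_star [Fintype V] {v : V} (hv : D.IsSource v) (x : A → ℝ) :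
    arcSum x (D.star v) = D.net x v := by
  rw [← hv.outCut_singleton, arcSum_outCut hv.inCut_singleton, arcSum_singleton]

theorem IsSink.arcSum_star [Fintype V] {v : V} (hv : D.IsSink v) (x : A → ℝ) :
    arcSum x (D.star v) = -D.net x v := by
  rw [← hv.outCut_compl_singleton, arcSum_outCut hv.inCut_compl_singleton, arcSum_compl,
    D.sum_net, arcSum_singleton, zero_sub]

theorem IsBipartite.arcSum_star_eq_iff [Fintype V] (hD : D.IsBipartite) (v : V) (x y : A → ℝ) :
    arcSum x (D.star v) = arcSum y (D.star v) ↔ D.net x v = D.net y v := by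
  rcases hD v with hv | hv
  · rw [hv.arcSum_star, hv.arcSum_star]
  · rw [hv.arcSum_star, hv.arcSum_star, neg_inj]

end Bip

/-! ### Relative interior and directions of the face -/

section Face

variable {V A : Type*} [Fintype A] {D : MultiDigraph V A} {𝓕 : Set (Set V)}

theorem convex_face : Convex ℝ (D.face 𝓕) := by
  rintro x ⟨⟨hx1, hx2⟩, hx3⟩ y ⟨⟨hy1, hy2⟩, hy3⟩ s t hs ht hst
  refine ⟨⟨fun W hW => ?_, fun a => ?_⟩, fun W hW => ?_⟩
  · rw [arcSum_add, arcSum_smul, arcSum_smul]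
    nlinarith [hx1 W hW, hy1 W hW]
  · simp only [Pi.add_apply, Pi.smul_apply, smul_eq_mul]
    nlinarith [hx2 a, hy2 a]
  · rw [arcSum_add, arcSum_smul, arcSum_smul, hx3 W hW, hy3 W hW]
    linarith

open scoped Classical in
/-- Any two nodes are joined by a unit flow along which a dijoin vector can be shifted. -/
theorem exists_flow {x : A → ℝ} (hx : x ∈ D.dij) (p q : V) :
    ∃ d : A → ℝ, (∀ b, x b = 0 → 0 ≤ d b) ∧ D.net d = Pi.single p 1 - Pi.single q 1 := by
  -- The residual digraph: arcs may always be used forwards, and backwards only where `x` is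
  -- nonzero.
  let R : V → V → Prop := fun u w =>
    (∃ a, D.tail a = u ∧ D.head a = w) ∨ ∃ a, x a ≠ 0 ∧ D.head a = u ∧ D.tail a = w
  have hreach : Relation.ReflTransGen R p q := by
    by_contra hq
    -- The unreachable nodes form a dicut, since forward steps are free. All its arcs have value
    -- zero, since nonzero ones could be used backwards; this contradicts value at least 1.
    have hdi : D.IsDicut {v | ¬ Relation.ReflTransGen R p v} := by
      refine ⟨⟨q, hq⟩, fun h => ?_, ?_⟩
      · have : p ∈ {v | ¬ Relation.ReflTransGen R p v} := h ▸ Set.mem_univ p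
        exact this Relation.ReflTransGen.refl
      · ext a
        simp only [inCut, Set.mem_ofPred_eq, not_not, Set.mem_empty_iff_false, iff_false, not_and]
        exact fun h => h.tail (Or.inl ⟨a, rfl, rfl⟩)
    have h1 := hx.1 _ hdi
    rw [arcSum_eq_zero] at h1
    · linarith
    · rintro a ⟨h2, h3⟩
      by_contra h4
      simp only [Set.mem_ofPred_eq, not_not] at h2 h3
      exact h2 (h3.tail (Or.inr ⟨a, h4, rfl, rfl⟩))
  have hnet : ∀ a, D.net (Pi.single a 1) = Pi.single (D.tail a) 1 - Pi.single (D.head a) 1 := by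
    intro a
    simp [net]
  clear hx
  induction hreach with
  | refl => exact ⟨0, by simp, by simp⟩
  | tail _ hR ih =>
    obtain ⟨d, hd, hn⟩ := ih
    rcases hR with ⟨a, rfl, rfl⟩ | ⟨a, ha, rfl, rfl⟩
    · refine ⟨d + Pi.single a 1, fun b hb => ?_, ?_⟩
      · have : (0 : ℝ) ≤ (Pi.single a 1 : A → ℝ) b := by
          rw [Pi.single_apply]; split_ifs <;> norm_num
        exact add_nonneg (hd b hb) this
      · rw [map_add, hn, hnet]; abel
    · refine ⟨d - Pi.single a 1, fun b hb => ?_, ?_⟩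
      · have : b ≠ a := by rintro rfl; exact ha hb
        simpa [Pi.single_eq_of_ne this] using hd b hb
      · rw [map_sub, hn, hnet]; abel

variable [Fintype V]

/-- A residual flow from the head of `a` back to its tail closes up with `a` to a circulation.
Adding a small multiple of it keeps all dicut values, keeps `x ≥ 0`, and makes the entry at `a`
positive. -/
theorem exists_mem_face_pos (hne : (D.face 𝓕).Nonempty) (h𝓕 : ∀ W ∈ 𝓕, D.inCut W = ∅) (a : A) :
    ∃ x ∈ D.face 𝓕, 0 < x a := by
  classical
  obtain ⟨x, hx⟩ := hne
  rcases (hx.1.2 a).lt_or_eq with h | h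
  · exact ⟨x, hx, h⟩
  obtain ⟨d, hd, hn⟩ := exists_flow hx.1 (D.head a) (D.tail a)
  obtain ⟨ε, hε, hlt⟩ := exists_pos_forall_lt (fun b : {b // 0 < x b} => x b)
    (fun b => (d + Pi.single a 1 : A → ℝ) b) (fun _ => 0) fun b => b.2
  have hnet : D.net (x + ε • (d + Pi.single a 1)) = D.net x := by
    rw [map_add, map_smul, map_add, hn]
    simp [net]
  have hcut : ∀ W, D.inCut W = ∅ →
      arcSum (x + ε • (d + Pi.single a 1)) (D.outCut W) = arcSum x (D.outCut W) := fun W hW => by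
    rw [arcSum_outCut hW, arcSum_outCut hW, hnet]
  refine ⟨x + ε • (d + Pi.single a 1), ⟨⟨fun W hW => ?_, fun b => ?_⟩, fun W hW => ?_⟩, ?_⟩
  · rw [hcut W hW.2.2]; exact hx.1.1 W hW
  · rcases (hx.1.2 b).lt_or_eq with hb | hb
    · exact (hlt ⟨b, hb⟩).le
    · have h1 : (0 : ℝ) ≤ (Pi.single a 1 : A → ℝ) b := by
        rw [Pi.single_apply]; split_ifs <;> norm_num
      have h2 := hd b hb.symm
      simp only [Pi.add_apply, Pi.smul_apply, smul_eq_mul, ← hb, zero_add]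
      positivity
  · rw [hcut W (h𝓕 W hW)]; exact hx.2 W hW
  · have h2 := hd a h.symm
    simp only [Pi.add_apply, Pi.smul_apply, smul_eq_mul, ← h, zero_add, Pi.single_eq_same]
    positivity

/-- The face contains a point satisfying strictly every inequality that is not an implicit
equation; no nonnegativity constraint is one. -/
theorem exists_interior_mem_face (hne : (D.face 𝓕).Nonempty) (h𝓕 : ∀ W ∈ 𝓕, D.inCut W = ∅) :
    ∃ x ∈ D.face 𝓕, (∀ a, 0 < x a) ∧
      ∀ W, D.IsDicut W → ¬ D.IsTightDicut 𝓕 W → 1 < arcSum x (D.outCut W) := by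
  obtain ⟨x, hx, h⟩ := convex_face.exists_forall_lt hne
    (ι := A ⊕ {W : Set V // D.IsDicut W ∧ ¬ D.IsTightDicut 𝓕 W})
    (Sum.elim (fun a => LinearMap.proj a) fun W => arcSumLin (D.outCut W.1))
    (Sum.elim (fun _ => 0) fun _ => 1)
    (by
      rintro (a | ⟨W, hW, _⟩) x hx
      · exact hx.1.2 a
      · exact hx.1.1 W hW)
    (by
      rintro (a | ⟨W, hW, hW'⟩)
      · exact exists_mem_face_pos hne h𝓕 a
      · have : ¬ D.face 𝓕 ⊆ {x | arcSum x (D.outCut W) = 1} := fun h => hW' ⟨hW, h⟩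
        obtain ⟨x, hx, hx1⟩ := Set.not_subset.1 this
        exact ⟨x, hx, (hx.1.1 W hW).lt_of_ne' hx1⟩)
  exact ⟨x, hx, fun a => h (.inl a), fun W h1 h2 => h (.inr ⟨W, h1, h2⟩)⟩

/-- From a point where only the tight dicuts hold with equality, a small step along `z` stays in the
face. -/
theorem mem_vectorSpan_face (hne : (D.face 𝓕).Nonempty) (h𝓕 : ∀ W ∈ 𝓕, D.IsDicut W) {z : A → ℝ}
    (hz : ∀ W, D.IsTightDicut 𝓕 W → arcSum z (D.outCut W) = 0) :
    z ∈ vectorSpan ℝ (D.face 𝓕) := by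
  obtain ⟨x, hx, hpos, hcut⟩ := exists_interior_mem_face hne fun W hW => (h𝓕 W hW).2.2
  obtain ⟨ε, hε, hlt⟩ := exists_pos_forall_lt
    (ι := A ⊕ {W : Set V // D.IsDicut W ∧ ¬ D.IsTightDicut 𝓕 W})
    (Sum.elim (fun a => x a) fun W => arcSum x (D.outCut W.1))
    (Sum.elim (fun a => z a) fun W => arcSum z (D.outCut W.1))
    (Sum.elim (fun _ => 0) fun _ => 1)
    (by
      rintro (a | ⟨W, h1, h2⟩)
      · exact hpos a
      · exact hcut W h1 h2)
  have hmem : x + ε • z ∈ D.face 𝓕 := by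
    refine ⟨⟨fun W hW => ?_, fun a => (hlt (.inl a)).le⟩, fun W hW => ?_⟩
    · by_cases ht : D.IsTightDicut 𝓕 W
      · rw [arcSum_add, arcSum_smul, hz W ht, mul_zero, add_zero]
        exact hx.1.1 W hW
      · rw [arcSum_add, arcSum_smul]
        exact (hlt (.inr ⟨W, hW, ht⟩)).le
    · rw [arcSum_add, arcSum_smul, hz W ⟨h𝓕 W hW, fun y hy => hy.2 W hW⟩, mul_zero, add_zero]
      exact hx.2 W hW
  have h1 := vsub_mem_vectorSpan ℝ hmem hx
  rw [vsub_eq_sub, add_sub_cancel_left] at h1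
  exact (Submodule.smul_mem_iff _ hε.ne').1 h1

end Face
end MultiDigraph

namespace MultiDigraph

/-! ### Separated digrafts are affine critical with slack zero -/

section Critical

variable {V A : Type*} [Fintype A] {D : MultiDigraph V A} {𝓕 : Set (Set V)}

theorem IsDigraft.isDicut (h : D.IsDigraft 𝓕) {W : Set V} (hW : W ∈ 𝓕) : D.IsDicut W :=
  ⟨Set.nonempty_iff_ne_empty.2 fun h0 => h.empty_notMem (h0 ▸ hW),
    fun h1 => h.univ_notMem (h1 ▸ hW), h.inCut_eq_empty W hW⟩

theorem IsDigraft.isTightNode_of_isSink (h : D.IsDigraft 𝓕) {v : V} (hv : D.IsSink v) :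
    D.IsTightNode 𝓕 v := fun x hx => by
  have := hx.2 _ (h.compl_sink_mem v hv)
  rwa [hv.outCut_compl_singleton] at this

theorem IsDigraft.isSource_of_not_isTightNode (h : D.IsDigraft 𝓕) {v : V}
    (hv : ¬ D.IsTightNode 𝓕 v) : D.IsSource v :=
  (h.bipartite v).resolve_right fun hs => hv (h.isTightNode_of_isSink hs)

theorem IsTightNode.arcSum_eq {v : V} (hv : D.IsTightNode 𝓕 v) {x : A → ℝ} (hx : x ∈ D.face 𝓕) :
    arcSum x (D.star v) = 1 := hv hx

theorem IsTightDicut.arcSum_eq {W : Set V} (hW : D.IsTightDicut 𝓕 W) {x : A → ℝ}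
    (hx : x ∈ D.face 𝓕) : arcSum x (D.outCut W) = 1 := hW.2 hx

/-- Every tight dicut has all active nodes on one of its two sides. -/
def Separated (D : MultiDigraph V A) (𝓕 : Set (Set V)) : Prop :=
  ∀ W, D.IsTightDicut 𝓕 W →
    (∀ v ∈ W, D.IsTightNode 𝓕 v) ∨ ∀ v ∉ W, D.IsTightNode 𝓕 v

/-- The small side of a tight dicut is one node. If that node were active it would be a source: as
the shore itself it would then be tight, and as the complement of the shore it would leave a cut
without arcs, of value 0 instead of 1. -/
theorem IsBasic.separated [Finite V] (h : D.IsBasic 𝓕) : D.Separated 𝓕 := by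
  intro W hW
  rcases (h.2 W hW).2 with h1 | h1
  · obtain ⟨v, rfl⟩ := Set.ncard_eq_one.1 h1
    refine Or.inl fun w hw => ?_
    obtain rfl : w = v := hw
    by_contra hv
    have hs := h.1.isSource_of_not_isTightNode hv
    exact hv fun x hx => by simpa [hs.outCut_singleton] using hW.2 hx
  · have h2 : Wᶜ.ncard = 1 := by
      have := Set.ncard_add_ncard_compl W
      omega
    obtain ⟨v, hv⟩ := Set.ncard_eq_one.1 h2
    refine Or.inr fun w hw => ?_
    obtain rfl : w = v := by
      have : w ∈ Wᶜ := hw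
      rwa [hv] at this
    by_contra hv'
    have hs := h.1.isSource_of_not_isTightNode hv'
    obtain ⟨x, hx⟩ := h.1.face_nonempty
    have h3 := hW.arcSum_eq hx
    rw [← compl_compl W, hv, hs.outCut_compl_singleton, arcSum_empty] at h3
    exact zero_ne_one h3

variable [Fintype V]

theorem IsDigraft.net_eq (h : D.IsDigraft 𝓕) {v : V} (hv : D.IsTightNode 𝓕 v) {x y : A → ℝ}
    (hx : x ∈ D.face 𝓕) (hy : y ∈ D.face 𝓕) : D.net x v = D.net y v :=
  (h.bipartite.arcSum_star_eq_iff v x y).1 ((hv.arcSum_eq hx).trans (hv.arcSum_eq hy).symm)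

/-- One side of a tight dicut has only tight nodes, so the net of `z` sums to zero there, and hence
on the other side as well because the total is zero. -/
theorem IsDigraft.mem_vectorSpan_iff (h : D.IsDigraft 𝓕) (hs : D.Separated 𝓕) {z : A → ℝ} :
    z ∈ vectorSpan ℝ (D.face 𝓕) ↔ ∀ v, D.IsTightNode 𝓕 v → D.net z v = 0 := by
  constructor
  · intro hz v hv
    exact vectorSpan_le_ker (LinearMap.proj v ∘ₗ D.net) (fun x hx y hy => h.net_eq hv hx hy) hz
  · intro hz
    refine mem_vectorSpan_face h.face_nonempty (fun W hW => h.isDicut hW) fun W hW => ?_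
    rw [arcSum_outCut hW.1.2.2]
    rcases hs W hW with h1 | h1
    · exact arcSum_eq_zero fun v hv => hz v (h1 v hv)
    · have h2 : arcSum (D.net z) Wᶜ = 0 := arcSum_eq_zero fun v hv => hz v (h1 v hv)
      rw [arcSum_compl, D.sum_net] at h2
      linarith

theorem IsDigraft.isAffineCritical (h : D.IsDigraft 𝓕) (hs : D.Separated 𝓕) :
    D.IsAffineCritical 𝓕 := by
  refine ⟨h, ?_⟩
  obtain ⟨y, hy⟩ := h.face_nonempty
  ext x
  have h1 : x ∈ affineSpan ℝ (D.face 𝓕) ↔ x - y ∈ vectorSpan ℝ (D.face 𝓕) := by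
    rw [← direction_affineSpan, ← vsub_eq_sub,
      AffineSubspace.vsub_right_mem_direction_iff_mem (mem_affineSpan ℝ hy)]
  rw [SetLike.mem_coe, h1, h.mem_vectorSpan_iff hs]
  refine forall₂_congr fun v hv => ?_
  rw [map_sub, Pi.sub_apply, sub_eq_zero, ← h.bipartite.arcSum_star_eq_iff v x y, hv.arcSum_eq hy]

/-- Outside any one node, the conservation constraints are linearly independent. -/
theorem finrank_net_eq_zero (hD : D.dij.Nonempty) (N : Set V) {r : V} (hr : r ∉ N)
    (K : Submodule ℝ (A → ℝ)) (hK : ∀ z, z ∈ K ↔ ∀ v ∈ N, D.net z v = 0) :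
    Module.finrank ℝ K + N.ncard = Fintype.card A := by
  classical
  let f : (A → ℝ) →ₗ[ℝ] (N → ℝ) := LinearMap.funLeft ℝ ℝ Subtype.val ∘ₗ D.net
  have hker : LinearMap.ker f = K := by
    ext z
    simp [hK, f, funext_iff, LinearMap.funLeft_apply]
  have hsurj : Function.Surjective f := by
    obtain ⟨x, hx⟩ := hD
    -- Flows from the nodes of `N` to `r` map to the standard basis: the `-1` at `r` is not seen, as
    -- `r ∉ N`.
    have key : ∀ p : V, ∃ d : A → ℝ, D.net d = Pi.single p 1 - Pi.single r 1 := fun p => by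
      obtain ⟨d, _, h⟩ := exists_flow hx p r
      exact ⟨d, by convert h⟩
    choose d hd using key
    intro c
    refine ⟨∑ p : N, c p • d p, ?_⟩
    ext v
    have hvr : (v : V) ≠ r := fun h => hr (h ▸ v.2)
    simp [f, LinearMap.funLeft_apply, hd, Pi.single_apply, hvr, Subtype.coe_inj]
  have h1 := LinearMap.finrank_range_add_finrank_ker f
  rw [LinearMap.range_eq_top.2 hsurj, finrank_top, hker, Module.finrank_fintype_fun_eq_card,
    Module.finrank_fintype_fun_eq_card] at h1
  rw [Set.ncard_eq_toFinset_card', Set.toFinset_card]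
  omega

/-- If some node is active, it serves as the omitted node and the tight equations are independent.
If all are tight, exactly one equation is redundant, which `κᵗ` accounts for. -/
theorem IsDigraft.slack_eq_zero (h : D.IsDigraft 𝓕) (hs : D.Separated 𝓕) : D.slack 𝓕 = 0 := by
  classical
  have hD : D.dij.Nonempty := h.face_nonempty.mono Set.inter_subset_left
  have hmem := fun z => h.mem_vectorSpan_iff hs (z := z)
  unfold slack affDim
  split_ifs with hall
  · obtain ⟨r⟩ := h.twoEdgeConnected.1
    have h1 := finrank_net_eq_zero hD {r}ᶜ (r := r) (by simp) (vectorSpan ℝ (D.face 𝓕)) fun z => by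
      rw [hmem]
      refine ⟨fun hz v _ => hz v (hall v), fun hz v _ => ?_⟩
      by_cases hv : v = r
      · subst hv
        have h2 : arcSum (D.net z) {v}ᶜ = 0 := arcSum_eq_zero hz
        rw [arcSum_compl, D.sum_net, arcSum_singleton] at h2
        linarith
      · exact hz v hv
    have h2 : ({v | D.IsTightNode 𝓕 v} : Set V) = Set.univ := Set.eq_univ_of_forall hall
    have h3 := Set.ncard_add_ncard_compl ({r} : Set V)
    rw [Set.ncard_singleton] at h3
    rw [h2, Set.ncard_univ]
    omega
  · push Not at hall
    obtain ⟨r, hr⟩ := hall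
    have h1 := finrank_net_eq_zero hD {v | D.IsTightNode 𝓕 v} (r := r) hr
      (vectorSpan ℝ (D.face 𝓕)) hmem
    omega

end Critical

/-! ### The facet of a dicut -/

section Facet

variable {V A : Type*} [Fintype A] {D : MultiDigraph V A} {𝓕 : Set (Set V)} {U : Set V}

theorem faceOf_outCut_eq_face_insert :
    faceOf (D.face 𝓕) (indVec (D.outCut U)) 1 = D.face (insert U 𝓕) := by
  ext x
  simp only [faceOf, face, Set.mem_inter_iff, Set.mem_ofPred_eq, Set.mem_insert_iff,
    forall_eq_or_imp]
  unfold arcSum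
  tauto

theorem face_insert_subset : D.face (insert U 𝓕) ⊆ D.face 𝓕 :=
  fun _ hx => ⟨hx.1, fun W hW => hx.2 W (Set.mem_insert_of_mem _ hW)⟩

theorem mem_face_insert {x : A → ℝ} :
    x ∈ D.face (insert U 𝓕) ↔ x ∈ D.face 𝓕 ∧ arcSum x (D.outCut U) = 1 := by
  rw [← faceOf_outCut_eq_face_insert]; rfl

theorem IsDigraft.insert_dicut (h : D.IsDigraft 𝓕) (hU : D.IsDicut U)
    (hne : (D.face (insert U 𝓕)).Nonempty) : D.IsDigraft (insert U 𝓕) where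
  bipartite := h.bipartite
  twoEdgeConnected := h.twoEdgeConnected
  empty_notMem := by
    rintro (h0 | h0)
    · exact hU.1.ne_empty h0.symm
    · exact h.empty_notMem h0
  univ_notMem := by
    rintro (h0 | h0)
    · exact hU.2.1 h0.symm
    · exact h.univ_notMem h0
  inCut_eq_empty := by
    rintro W (rfl | hW)
    · exact hU.2.2
    · exact h.inCut_eq_empty W hW
  compl_sink_mem v hv := Set.mem_insert_of_mem _ (h.compl_sink_mem v hv)
  face_nonempty := hne

theorem FacetDefining.exists_one_lt
    (hf : FacetDefining (D.face 𝓕) (indVec (D.outCut U)) 1) :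
    ∃ x ∈ D.face 𝓕, 1 < arcSum x (D.outCut U) := by
  by_contra! hcon
  have : faceOf (D.face 𝓕) (indVec (D.outCut U)) 1 = D.face 𝓕 := by
    ext x
    exact ⟨fun hx => hx.1, fun hx => ⟨hx, le_antisymm (hcon x hx) (hf.1 x hx)⟩⟩
  have h1 := hf.2.2
  rw [this] at h1
  omega

/-- A dimension count: the directions of the facet lie in `H`, which is a proper subspace of the
directions of the face, and the facet has dimension only one less. -/
theorem mem_vectorSpan_face_insert (hf : FacetDefining (D.face 𝓕) (indVec (D.outCut U)) 1)
    {z : A → ℝ} (hz : z ∈ vectorSpan ℝ (D.face 𝓕)) (hzU : arcSum z (D.outCut U) = 0) :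
    z ∈ vectorSpan ℝ (D.face (insert U 𝓕)) := by
  have hdim := hf.2.2
  have hne := hf.2.1
  rw [faceOf_outCut_eq_face_insert] at hdim hne
  unfold affDim at hdim
  set H := vectorSpan ℝ (D.face 𝓕) ⊓ LinearMap.ker (arcSumLin (D.outCut U)) with hH
  have h1 : vectorSpan ℝ (D.face (insert U 𝓕)) ≤ H := le_inf
    (vectorSpan_mono ℝ face_insert_subset)
    (vectorSpan_le_ker _ fun x hx y hy =>
      (mem_face_insert.1 hx).2.trans (mem_face_insert.1 hy).2.symm)
  have h2 : H < vectorSpan ℝ (D.face 𝓕) := by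
    refine lt_of_le_of_ne inf_le_left fun heq => ?_
    obtain ⟨x, hx, hx1⟩ := FacetDefining.exists_one_lt hf
    obtain ⟨y, hy⟩ := hne
    obtain ⟨hy, hy1⟩ := mem_face_insert.1 hy
    have h3 : x - y ∈ H := heq ▸ vsub_mem_vectorSpan ℝ hx hy
    have h4 : arcSum (x - y) (D.outCut U) = 0 := h3.2
    rw [arcSum_sub] at h4
    linarith
  have h3 := Submodule.finrank_lt_finrank_of_lt h2
  rw [Submodule.eq_of_le_of_finrank_le h1 (by omega)]
  exact ⟨hz, hzU⟩

variable [Fintype V]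

/-- A dicut that is tight on the facet of `U` does not separate active nodes on one side of `U`. -/
theorem IsBasic.mem_iff_mem (hb : D.IsBasic 𝓕) (hU : D.IsDicut U)
    (hf : FacetDefining (D.face 𝓕) (indVec (D.outCut U)) 1) {p q : V}
    (hp : ¬ D.IsTightNode 𝓕 p) (hq : ¬ D.IsTightNode 𝓕 q) (hpq : p ∈ U ↔ q ∈ U) {W : Set V}
    (hW : D.IsTightDicut (insert U 𝓕) W) : p ∈ W ↔ q ∈ W := by
  classical
  obtain ⟨x, hx⟩ := hb.1.face_nonempty
  -- The net of `d` is nonzero only at active nodes, and its value on a dicut is nonzero only if the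
  -- dicut separates `p` from `q`.
  obtain ⟨d, -, hd⟩ := exists_flow hx.1 p q
  have hcut : ∀ W : Set V, D.inCut W = ∅ →
      arcSum d (D.outCut W) = (if p ∈ W then 1 else 0) - if q ∈ W then 1 else 0 := fun W hW => by
    rw [arcSum_outCut hW, hd, arcSum_sub]
    simp [arcSum, indVec, Set.indicator_apply]
  have hmem : d ∈ vectorSpan ℝ (D.face 𝓕) := by
    rw [hb.1.mem_vectorSpan_iff hb.separated]
    intro v hv
    have h1 : v ≠ p := by rintro rfl; exact hp hv
    have h2 : v ≠ q := by rintro rfl; exact hq hv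
    simp [hd, h1, h2]
  have hmem' := mem_vectorSpan_face_insert hf hmem (by rw [hcut U hU.2.2]; simp [hpq])
  have h0 : arcSum d (D.outCut W) = 0 := vectorSpan_le_ker (arcSumLin (D.outCut W))
    (fun x hx y hy => (hW.arcSum_eq hx).trans (hW.arcSum_eq hy).symm) hmem'
  rw [hcut W hW.1.2.2] at h0
  by_cases h1 : p ∈ W <;> by_cases h2 : q ∈ W <;> simp_all

end Facet
end MultiDigraph

namespace MultiDigraph

/-! ### Active nodes on the facet -/

section ActiveOnFacet

variable {V A : Type*} [Fintype A] {D : MultiDigraph V A} {𝓕 : Set (Set V)} {U : Set V}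

theorem IsSource.isDicut (h : D.IsDigraft 𝓕) {v : V} (hs : D.IsSource v) : D.IsDicut {v} := by
  refine ⟨Set.singleton_nonempty v, fun hv => ?_, hs.inCut_singleton⟩
  -- If `v` were the only node, either it is a sink and `∅` lies in the family, or it has a leaving
  -- arc that must also end in `v`.
  by_cases hk : D.IsSink v
  · have h1 := h.compl_sink_mem v hk
    rw [hv, Set.compl_univ] at h1
    exact h.empty_notMem h1
  · unfold IsSink at hk
    push Not at hk
    obtain ⟨a, _⟩ := hk
    have : D.head a ∈ ({v} : Set V) := hv ▸ Set.mem_univ _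
    exact hs a this

theorem IsSource.isTightDicut_iff (h : D.IsDigraft 𝓕) {v : V} (hs : D.IsSource v)
    {𝓖 : Set (Set V)} : D.IsTightDicut 𝓖 {v} ↔ D.IsTightNode 𝓖 v := by
  unfold IsTightDicut IsTightNode
  rw [hs.outCut_singleton]
  exact and_iff_right (hs.isDicut h)

variable [Fintype V]

/-- The value of `δ⁺(U)` is not constant on the face, whereas it would be if the net were constant
at every node of `U`. -/
theorem IsBasic.exists_active_mem (hb : D.IsBasic 𝓕) (hU : D.IsDicut U)
    (hf : FacetDefining (D.face 𝓕) (indVec (D.outCut U)) 1) :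
    ∃ v ∈ U, ¬ D.IsTightNode 𝓕 v := by
  by_contra! hall
  obtain ⟨x, hx, hx1⟩ := FacetDefining.exists_one_lt hf
  obtain ⟨y, hy, hy1⟩ := hf.2.1
  change arcSum y _ = 1 at hy1
  rw [arcSum_outCut hU.2.2] at hx1 hy1
  have : arcSum (D.net x - D.net y) U = 0 := arcSum_eq_zero fun v hv => by
    rw [Pi.sub_apply, hb.1.net_eq (hall v hv) hx hy, sub_self]
  rw [arcSum_sub] at this
  linarith

theorem IsBasic.exists_active_notMem (hb : D.IsBasic 𝓕) (hU : D.IsDicut U)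
    (hf : FacetDefining (D.face 𝓕) (indVec (D.outCut U)) 1) :
    ∃ v ∉ U, ¬ D.IsTightNode 𝓕 v := by
  by_contra! hall
  obtain ⟨x, hx, hx1⟩ := FacetDefining.exists_one_lt hf
  obtain ⟨y, hy, hy1⟩ := hf.2.1
  change arcSum y _ = 1 at hy1
  rw [arcSum_outCut hU.2.2] at hx1 hy1
  have : arcSum (D.net x - D.net y) Uᶜ = 0 := arcSum_eq_zero fun v hv => by
    rw [Pi.sub_apply, hb.1.net_eq (hall v hv) hx hy, sub_self]
  rw [arcSum_compl, arcSum_sub] at this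
  simp only [Pi.sub_apply, Finset.sum_sub_distrib, D.sum_net] at this
  linarith

/-- Active nodes stay active on the facet of `U`. -/
theorem IsBasic.isTightNode_insert_iff (hb : D.IsBasic 𝓕) (hU : D.IsDicut U)
    (hf : FacetDefining (D.face 𝓕) (indVec (D.outCut U)) 1)
    (hnontriv : ∀ u, D.IsActiveSource 𝓕 u →
      ¬ EquivIneq (D.face 𝓕) (indVec (D.outCut U)) 1 (indVec (D.outCut {u})) 1) (v : V) :
    D.IsTightNode (insert U 𝓕) v ↔ D.IsTightNode 𝓕 v := by
  refine ⟨fun hv => ?_, fun hv => face_insert_subset.trans hv⟩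
  by_contra hact
  have hs := hb.1.isSource_of_not_isTightNode hact
  have htd := (hs.isTightDicut_iff hb.1).2 hv
  -- A dicut `{v}` tight on the facet cannot separate `v` from another active node on its side of
  -- `U`.
  have huniq : ∀ w, ¬ D.IsTightNode 𝓕 w → (v ∈ U ↔ w ∈ U) → w = v := fun w hw hvw =>
    (hb.mem_iff_mem hU hf hact hw hvw htd).1 rfl
  obtain ⟨y, hy, hy1⟩ := hf.2.1
  have hyv := hv.arcSum_eq (mem_face_insert.2 ⟨hy, hy1⟩)
  change arcSum y _ = 1 at hy1
  rw [hs.arcSum_star] at hyv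
  rw [arcSum_outCut hU.2.2] at hy1
  have hdiff : ∀ x ∈ D.face 𝓕, ∀ w, w ≠ v → (v ∈ U ↔ w ∈ U) → (D.net x - D.net y) w = 0 :=
    fun x hx w hw hvw => by
      have hw' : D.IsTightNode 𝓕 w := by
        by_contra h
        exact hw (huniq w h hvw)
      rw [Pi.sub_apply, hb.1.net_eq hw' hx hy, sub_self]
  -- If `v ∈ U`, the values of `δ⁺(U)` and `δ⁺(v)` vary by the same amount and are both 1 at `y`, so
  -- they define the same face.
  by_cases hvU : v ∈ U
  · refine hnontriv v ⟨hs, hact⟩ ?_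
    ext x
    refine and_congr_right fun hx => ?_
    change arcSum x _ = 1 ↔ arcSum x _ = 1
    rw [hs.outCut_singleton, hs.arcSum_star, arcSum_outCut hU.2.2]
    have h1 : arcSum (D.net x - D.net y) U = (D.net x - D.net y) v := by
      classical
      rw [arcSum_eq_sum, Finset.sum_eq_single v, if_pos hvU]
      · intro w _ hw
        split_ifs with hwU
        · exact hdiff x hx w hw (iff_of_true hvU hwU)
        · rfl
      · simp
    rw [arcSum_sub, Pi.sub_apply] at h1
    constructor <;> intro <;> linarith
  -- If `v ∉ U`, the two values vary oppositely, so a point with `x(δ⁺(U)) > 1` would have `x(δ⁺(v))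
  -- < 1`.
  · obtain ⟨x, hx, hx1⟩ := FacetDefining.exists_one_lt hf
    have hxv := hx.1.1 _ (hs.isDicut hb.1)
    rw [hs.outCut_singleton, hs.arcSum_star] at hxv
    rw [arcSum_outCut hU.2.2] at hx1
    have h1 : arcSum (D.net x - D.net y) Uᶜ = (D.net x - D.net y) v := by
      classical
      rw [arcSum_eq_sum, Finset.sum_eq_single v, if_pos (show v ∈ Uᶜ from hvU)]
      · intro w _ hw
        split_ifs with hwU
        · exact hdiff x hx w hw (iff_of_false hvU hwU)
        · rfl
      · simp
    rw [arcSum_compl, arcSum_sub, Pi.sub_apply] at h1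
    simp only [Pi.sub_apply, Finset.sum_sub_distrib, D.sum_net] at h1
    linarith

end ActiveOnFacet

/-! ### Shrinking a shore: cuts, families and tightness -/

section Shrink

variable {V A : Type*} {D : MultiDigraph V A} {S : Set V}

theorem shrinkMap_eq_none {v : V} : shrinkMap S v = none ↔ v ∈ S := by
  unfold shrinkMap; split_ifs with h <;> simp [h]

theorem shrinkMap_eq_some {v : V} {w : ↥Sᶜ} : shrinkMap S v = some w ↔ v = w := by
  unfold shrinkMap
  split_ifs with h
  · simp only [false_iff]
    rintro rfl
    exact w.2 h
  · simp [Subtype.ext_iff]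

theorem shrinkMap_surjective (hS : S.Nonempty) : Function.Surjective (shrinkMap S) := by
  rintro (_ | w)
  · obtain ⟨v, hv⟩ := hS
    exact ⟨v, shrinkMap_eq_none.2 hv⟩
  · exact ⟨w, shrinkMap_eq_some.2 rfl⟩

/-- The arc of `D` from which an arc of the shrunk digraph arises. -/
def ShrinkArc.arc (a : D.ShrinkArc S) : A := a.1

theorem ShrinkArc.arc_injective : Function.Injective (ShrinkArc.arc : D.ShrinkArc S → A) :=
  Subtype.val_injective

theorem ShrinkArc.range_arc : Set.range (ShrinkArc.arc : D.ShrinkArc S → A) =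
    {a | ¬ (D.tail a ∈ S ∧ D.head a ∈ S)} := Subtype.range_coe_subtype

theorem outCut_shrink (W : Set (ShrinkNode S)) :
    (D.shrink S).outCut W = ShrinkArc.arc ⁻¹' D.outCut (shrinkMap S ⁻¹' W) := rfl

theorem inCut_shrink (W : Set (ShrinkNode S)) :
    (D.shrink S).inCut W = ShrinkArc.arc ⁻¹' D.inCut (shrinkMap S ⁻¹' W) := rfl

theorem survives_of_ne {a : A} (h : shrinkMap S (D.tail a) ≠ shrinkMap S (D.head a)) :
    ¬ (D.tail a ∈ S ∧ D.head a ∈ S) := fun ⟨h1, h2⟩ =>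
  h ((shrinkMap_eq_none.2 h1).trans (shrinkMap_eq_none.2 h2).symm)

theorem outCut_preimage_subset (W : Set (ShrinkNode S)) :
    D.outCut (shrinkMap S ⁻¹' W) ⊆ {a | ¬ (D.tail a ∈ S ∧ D.head a ∈ S)} := fun _ ha =>
  survives_of_ne fun h => ha.2 (show _ ∈ W from h ▸ ha.1)

theorem inCut_preimage_subset (W : Set (ShrinkNode S)) :
    D.inCut (shrinkMap S ⁻¹' W) ⊆ {a | ¬ (D.tail a ∈ S ∧ D.head a ∈ S)} := fun _ ha =>
  survives_of_ne fun h => ha.1 (show _ ∈ W from h ▸ ha.2)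

theorem inCut_shrink_eq_empty {W : Set (ShrinkNode S)} :
    (D.shrink S).inCut W = ∅ ↔ D.inCut (shrinkMap S ⁻¹' W) = ∅ := by
  rw [inCut_shrink, Set.preimage_eq_empty_iff, ShrinkArc.range_arc]
  refine ⟨fun h => ?_, fun h => by simp [h]⟩
  exact disjoint_self.1 (h.mono_right (inCut_preimage_subset W))

theorem isDicut_shrink (hS : S.Nonempty) {W : Set (ShrinkNode S)} :
    (D.shrink S).IsDicut W ↔ D.IsDicut (shrinkMap S ⁻¹' W) := by
  have hsurj := shrinkMap_surjective hS
  refine and_congr ⟨fun h => h.preimage hsurj, fun ⟨v, hv⟩ => ⟨_, hv⟩⟩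
    (and_congr (not_congr ?_) inCut_shrink_eq_empty)
  rw [← Set.preimage_univ (f := shrinkMap S), hsurj.preimage_injective.eq_iff]

theorem star_shrink_some (v : ↥Sᶜ) :
    (D.shrink S).star (some v) = ShrinkArc.arc ⁻¹' D.star (v : V) := by
  ext a
  exact or_congr shrinkMap_eq_some shrinkMap_eq_some

theorem star_subset_survives (v : ↥Sᶜ) :
    D.star (v : V) ⊆ {a | ¬ (D.tail a ∈ S ∧ D.head a ∈ S)} := by
  rintro a (ha | ha) ⟨h1, h2⟩
  · exact v.2 (ha ▸ h1)
  · exact v.2 (ha ▸ h2)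

theorem preimage_singleton_some (v : ↥Sᶜ) : shrinkMap S ⁻¹' {some v} = {(v : V)} := by
  ext w; simp [shrinkMap_eq_some]

theorem preimage_singleton_none : shrinkMap S ⁻¹' {none} = S := by
  ext w; simp [shrinkMap_eq_none]

theorem isSource_shrink_some {v : ↥Sᶜ} :
    (D.shrink S).IsSource (some v) ↔ D.IsSource (v : V) := by
  refine ⟨fun h a ha => ?_, fun h a ha => h a.1 (shrinkMap_eq_some.1 ha)⟩
  exact h ⟨a, fun h' => v.2 (ha ▸ h'.2)⟩ (shrinkMap_eq_some.2 ha)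

theorem isSink_shrink_some {v : ↥Sᶜ} :
    (D.shrink S).IsSink (some v) ↔ D.IsSink (v : V) := by
  refine ⟨fun h a ha => ?_, fun h a ha => h a.1 (shrinkMap_eq_some.1 ha)⟩
  exact h ⟨a, fun h' => v.2 (ha ▸ h'.1)⟩ (shrinkMap_eq_some.2 ha)

theorem isSource_shrink_none (hS : D.inCut S = ∅) : (D.shrink S).IsSource none := by
  intro a ha
  have h2 := shrinkMap_eq_none.1 ha
  have : a.1 ∈ D.inCut S := ⟨fun h1 => a.2 ⟨h1, h2⟩, h2⟩
  simp [hS] at this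

theorem isSink_shrink_none (hS : D.outCut S = ∅) : (D.shrink S).IsSink none := by
  intro a ha
  have h2 := shrinkMap_eq_none.1 ha
  have : a.1 ∈ D.outCut S := ⟨h2, fun h1 => a.2 ⟨h2, h1⟩⟩
  simp [hS] at this

theorem preimage_keepSet (W : Set V) : shrinkMap S ⁻¹' keepSet S W = W \ S := by
  ext v
  by_cases hv : v ∈ S <;> simp [keepSet, shrinkMap, hv]

theorem outCut_compl (U : Set V) : D.outCut Uᶜ = D.inCut U := by
  ext a; simp [outCut, inCut]

theorem twoEdgeConnected_shrink (h : D.IsTwoEdgeConnected) (hS : S.Nonempty) :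
    (D.shrink S).IsTwoEdgeConnected := by
  refine ⟨⟨none⟩, fun W hW hW' => ?_⟩
  have hsurj := shrinkMap_surjective hS
  have h1 := h.2 (shrinkMap S ⁻¹' W) (hW.preimage hsurj) fun he => hW' (by
    rwa [← Set.preimage_univ (f := shrinkMap S), hsurj.preimage_injective.eq_iff] at he)
  rw [outCut_shrink, inCut_shrink, ← Set.preimage_union,
    Set.ncard_preimage_of_injective_subset_range ShrinkArc.arc_injective]
  · exact h1
  · rw [ShrinkArc.range_arc]
    exact Set.union_subset (outCut_preimage_subset W) (inCut_preimage_subset W)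

variable [Fintype A]

/-- Applied to cuts of pulled-back sets and to stars of surviving nodes, neither of which contains
an arc inside `S`, so restriction loses nothing. -/
theorem arcSum_comp_val {B : Set A} (hB : B ⊆ {a | ¬ (D.tail a ∈ S ∧ D.head a ∈ S)}) (x : A → ℝ) :
    arcSum (fun a : D.ShrinkArc S => x a.arc) (ShrinkArc.arc ⁻¹' B) = arcSum x B := by
  classical
  rw [arcSum_eq_sum, arcSum_eq_sum]
  refine Finset.sum_of_injOn ShrinkArc.arc ShrinkArc.arc_injective.injOn
    (fun _ _ => Finset.mem_coe.2 (Finset.mem_univ _)) ?_ ?_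
  · intro a _ ha
    rw [if_neg]
    intro haB
    exact ha ⟨⟨a, hB haB⟩, Finset.mem_coe.2 (Finset.mem_univ _), rfl⟩
  · intro a _
    rfl

variable {𝓕 : Set (Set V)} {U : Set V}

/-- Sets that contain `S` or miss it are exactly the preimages under `shrinkMap`, so both cases of
the definition become one pullback condition. -/
theorem mem_contractFamily_iff {W : Set (ShrinkNode S)} :
    W ∈ D.contractFamily 𝓕 U S ↔ D.IsTightDicut (insert U 𝓕) (shrinkMap S ⁻¹' W) := by
  constructor
  · rintro ⟨W', hW', ⟨h, rfl⟩ | ⟨h, rfl⟩⟩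
    · rw [preimage_keepSet, (Set.disjoint_iff_inter_eq_empty.2 h).sdiff_eq_left]
      exact hW'
    · rw [Set.insert_eq none, Set.preimage_union, preimage_singleton_none, preimage_keepSet,
        Set.union_sdiff_cancel h]
      exact hW'
  · intro h
    refine ⟨_, h, ?_⟩
    by_cases hn : none ∈ W
    · refine Or.inr ⟨fun v hv => ?_, ?_⟩
      · simpa [shrinkMap_eq_none.2 hv] using hn
      · ext (_ | v)
        · simp [hn]
        · have : shrinkMap S (v : V) = some v := shrinkMap_eq_some.2 rfl
          simp [keepSet, this]
    · refine Or.inl ⟨?_, ?_⟩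
      · ext v
        simp only [Set.mem_inter_iff, Set.mem_preimage, Set.mem_empty_iff_false, iff_false, not_and]
        intro h1 hv
        rw [shrinkMap_eq_none.2 hv] at h1
        exact hn h1
      · ext (_ | v)
        · simp [hn, keepSet]
        · have : shrinkMap S (v : V) = some v := shrinkMap_eq_some.2 rfl
          simp [keepSet, this]

/-- Transfers tightness from the contraction to `D`. The converse needs no extension of vectors,
because the contracted family already contains every dicut whose pullback is tight. -/
theorem restrict_mem_face (hS : S.Nonempty) {x : A → ℝ} (hx : x ∈ D.face (insert U 𝓕)) :
    (fun a : D.ShrinkArc S => x a.arc) ∈ (D.shrink S).face (D.contractFamily 𝓕 U S) := by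
  refine ⟨⟨fun W hW => ?_, fun a => hx.1.2 a.1⟩, fun W hW => ?_⟩
  · rw [outCut_shrink, arcSum_comp_val (outCut_preimage_subset W)]
    exact hx.1.1 _ ((isDicut_shrink hS).1 hW)
  · rw [outCut_shrink, arcSum_comp_val (outCut_preimage_subset W)]
    exact (mem_contractFamily_iff.1 hW).arcSum_eq hx

theorem isTightDicut_of_shrink (hS : S.Nonempty) {W : Set (ShrinkNode S)}
    (hW : (D.shrink S).IsTightDicut (D.contractFamily 𝓕 U S) W) :
    D.IsTightDicut (insert U 𝓕) (shrinkMap S ⁻¹' W) := by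
  refine ⟨(isDicut_shrink hS).1 hW.1, fun x hx => ?_⟩
  have := hW.arcSum_eq (restrict_mem_face hS hx)
  rwa [outCut_shrink, arcSum_comp_val (outCut_preimage_subset W)] at this

theorem isTightNode_of_shrink (hS : S.Nonempty) {v : ↥Sᶜ}
    (hv : (D.shrink S).IsTightNode (D.contractFamily 𝓕 U S) (some v)) :
    D.IsTightNode (insert U 𝓕) (v : V) := fun x hx => by
  have := hv.arcSum_eq (restrict_mem_face hS hx)
  rwa [star_shrink_some, arcSum_comp_val (star_subset_survives v)] at this

theorem IsDigraft.isTightDicut_compl (h : D.IsDigraft 𝓕) {v : V} (hv : D.IsSink v) :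
    D.IsTightDicut 𝓕 {v}ᶜ :=
  ⟨h.isDicut (h.compl_sink_mem v hv), fun _ hx => hx.2 _ (h.compl_sink_mem v hv)⟩

theorem isTightDicut_insert_self (hU : D.IsDicut U) : D.IsTightDicut (insert U 𝓕) U :=
  ⟨hU, fun _ hx => (mem_face_insert.1 hx).2⟩

theorem IsDigraft.shrink (h : D.IsDigraft (insert U 𝓕)) (hU : D.IsDicut U)
    (hSU : S = U ∨ S = Uᶜ) : (D.shrink S).IsDigraft (D.contractFamily 𝓕 U S) := by
  have hS : S.Nonempty := by
    rcases hSU with rfl | rfl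
    · exact hU.1
    · exact Set.nonempty_compl.2 hU.2.1
  refine ⟨?_, twoEdgeConnected_shrink h.twoEdgeConnected hS, fun h0 => ?_, fun h0 => ?_,
    fun W hW => ?_, ?_, ?_⟩
  · rintro (_ | v)
    · rcases hSU with rfl | rfl
      · exact Or.inl (isSource_shrink_none hU.2.2)
      · exact Or.inr (isSink_shrink_none ((outCut_compl U).trans hU.2.2))
    · exact (h.bipartite v).imp isSource_shrink_some.2 isSink_shrink_some.2
  · simpa using (mem_contractFamily_iff.1 h0).1.1
  · simpa using (mem_contractFamily_iff.1 h0).1.2.1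
  · exact inCut_shrink_eq_empty.2 (mem_contractFamily_iff.1 hW).1.2.2
  · rintro (_ | v) hv
    · rw [mem_contractFamily_iff, Set.preimage_compl, preimage_singleton_none]
      rcases hSU with rfl | rfl
      -- The new node is a source here; were it a sink too, no arc would join `S` to the rest.
      · have h1 := h.twoEdgeConnected.2 S hU.1 hU.2.1
        have h2 : D.outCut S = ∅ := by
          ext a
          simp only [Set.mem_empty_iff_false, iff_false]
          rintro ⟨h1, h2⟩
          exact hv ⟨a, fun h => h2 h.2⟩ (shrinkMap_eq_none.2 h1)
        simp [h2, hU.2.2] at h1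
      · rw [compl_compl]
        exact isTightDicut_insert_self hU
    · rw [mem_contractFamily_iff, Set.preimage_compl, preimage_singleton_some]
      exact h.isTightDicut_compl (isSink_shrink_some.1 hv)
  · obtain ⟨x, hx⟩ := h.face_nonempty
    exact ⟨_, restrict_mem_face hS hx⟩

theorem IsDigraft.isTightNode_shrink_some (h : D.IsDigraft (insert U 𝓕)) (hU : D.IsDicut U)
    (hSU : S = U ∨ S = Uᶜ) (hS : S.Nonempty) (v : ↥Sᶜ) :
    (D.shrink S).IsTightNode (D.contractFamily 𝓕 U S) (some v) ↔
      D.IsTightNode (insert U 𝓕) (v : V) := by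
  refine ⟨isTightNode_of_shrink hS, fun hv => ?_⟩
  rcases h.bipartite v with hs | hs
  · have h1 := (hs.isTightDicut_iff h).2 hv
    rw [← preimage_singleton_some, ← mem_contractFamily_iff] at h1
    intro x hx
    have h2 := hx.2 _ h1
    rwa [(isSource_shrink_some.2 hs).outCut_singleton] at h2
  · exact (h.shrink hU hSU).isTightNode_of_isSink (isSink_shrink_some.2 hs)

theorem IsDigraft.isTightNode_shrink_none (h : D.IsDigraft (insert U 𝓕)) (hU : D.IsDicut U)
    (hSU : S = U ∨ S = Uᶜ) :
    (D.shrink S).IsTightNode (D.contractFamily 𝓕 U S) none := by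
  rcases hSU with rfl | rfl
  · have h1 : {none} ∈ D.contractFamily 𝓕 S S := by
      rw [mem_contractFamily_iff, preimage_singleton_none]
      exact isTightDicut_insert_self hU
    intro x hx
    have h2 := hx.2 _ h1
    rwa [(isSource_shrink_none hU.2.2).outCut_singleton] at h2
  · exact (h.shrink hU (Or.inr rfl)).isTightNode_of_isSink
      (isSink_shrink_none ((outCut_compl U).trans hU.2.2))

end Shrink

/-! ### Contractibility and separation in the contractions -/

section Contraction

variable {V A : Type*} [Finite V] [Fintype A] {D : MultiDigraph V A} {𝓕 : Set (Set V)} {U : Set V}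

/-- Both sides of `U` contain active sources. If `U` were a single node, its inequality would be
that of an active source; if `Uᶜ` were, no arc would leave `U`. -/
theorem IsBasic.isContractible (hb : D.IsBasic 𝓕) (hU : D.IsDicut U)
    (hf : FacetDefining (D.face 𝓕) (indVec (D.outCut U)) 1)
    (hnontriv : ∀ u, D.IsActiveSource 𝓕 u →
      ¬ EquivIneq (D.face 𝓕) (indVec (D.outCut U)) 1 (indVec (D.outCut {u})) 1) :
    D.IsContractible 𝓕 U := by
  cases nonempty_fintype V
  obtain ⟨p, hp, hpa⟩ := hb.exists_active_mem hU hf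
  obtain ⟨q, hq, hqa⟩ := hb.exists_active_notMem hU hf
  have hps := hb.1.isSource_of_not_isTightNode hpa
  have hqs := hb.1.isSource_of_not_isTightNode hqa
  refine ⟨hU, ?_, ?_, hf.2.1⟩
  · have h0 : 0 < U.ncard := (Set.ncard_pos).2 hU.1
    by_contra h1
    obtain ⟨v, hv⟩ := Set.ncard_eq_one.1 (show U.ncard = 1 by omega)
    obtain rfl : p = v := by rw [hv] at hp; exact hp
    exact hnontriv p ⟨hps, hpa⟩ (by rw [EquivIneq, hv])
  · have h0 : 0 < Uᶜ.ncard := (Set.ncard_pos).2 ⟨q, hq⟩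
    have h2 := Set.ncard_add_ncard_compl U
    by_contra h1
    obtain ⟨v, hv⟩ := Set.ncard_eq_one.1 (show Uᶜ.ncard = 1 by omega)
    obtain rfl : q = v := by
      have : q ∈ Uᶜ := hq
      rw [hv] at this; exact this
    obtain ⟨y, hy, hy1⟩ := hf.2.1
    change arcSum y _ = 1 at hy1
    rw [← compl_compl U, hv, hqs.outCut_compl_singleton, arcSum_empty] at hy1
    exact zero_ne_one hy1

/-- The new node is tight, so all active nodes of the contraction come from one side of `U`, where
`IsBasic.mem_iff_mem` applies to the pulled-back dicut. -/
theorem IsBasic.separated_shrink (hb : D.IsBasic 𝓕) (hU : D.IsDicut U)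
    (hf : FacetDefining (D.face 𝓕) (indVec (D.outCut U)) 1)
    (hd : D.IsDigraft (insert U 𝓕)) {S : Set V} (hSU : S = U ∨ S = Uᶜ) (hS : S.Nonempty) :
    (D.shrink S).Separated (D.contractFamily 𝓕 U S) := by
  cases nonempty_fintype V
  intro W hW
  by_contra! hcon
  obtain ⟨⟨p', hpW, hp⟩, q', hqW, hq⟩ := hcon
  rcases p' with _ | p
  · exact hp (hd.isTightNode_shrink_none hU hSU)
  rcases q' with _ | q
  · exact hq (hd.isTightNode_shrink_none hU hSU)
  rw [hd.isTightNode_shrink_some hU hSU hS] at hp hq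
  have hpq : (p : V) ∈ U ↔ (q : V) ∈ U := by
    have h1 := p.2
    have h2 := q.2
    rcases hSU with rfl | rfl
    · exact iff_of_false h1 h2
    · exact iff_of_true (not_not.1 h1) (not_not.1 h2)
  have h1 := hb.mem_iff_mem hU hf (fun h => hp (face_insert_subset.trans h))
    (fun h => hq (face_insert_subset.trans h)) hpq (isTightDicut_of_shrink hS hW)
  rw [Set.mem_preimage, Set.mem_preimage, shrinkMap_eq_some.2 rfl, shrinkMap_eq_some.2 rfl] at h1
  exact hqW (h1.1 hpW)

end Contraction

end MultiDigraph

/-! ### The Affine Critical Lemma -/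

theorem lemma1p9 {V A : Type*} [Finite V] [Fintype A] (D : MultiDigraph V A) (𝓕 : Set (Set V))
    (hbasic : D.IsBasic 𝓕) (hrobust : ¬ D.IsRobust 𝓕)
    (U : Set V) (hU : D.IsDicut U)
    (hfacet : FacetDefining (D.face 𝓕) (indVec (D.outCut U)) 1)
    (hnontriv : ∀ u, D.IsActiveSource 𝓕 u →
      ¬ EquivIneq (D.face 𝓕) (indVec (D.outCut U)) 1 (indVec (D.outCut {u})) 1) :
    D.IsContractible 𝓕 U ∧
    (D.IsAffineCritical 𝓕 ∧ D.slack 𝓕 = 0 ∧ ∃ u, D.IsActiveSource 𝓕 u) ∧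
    ∀ S : Set V, S = U ∨ S = Uᶜ →
      ((D.shrink S).IsAffineCritical (D.contractFamily 𝓕 U S) ∧
        (D.shrink S).slack (D.contractFamily 𝓕 U S) = 0 ∧
        ∃ w, (D.shrink S).IsActiveSource (D.contractFamily 𝓕 U S) w) ∧
      ∀ w : MultiDigraph.ShrinkNode S,
        (D.shrink S).IsActiveSource (D.contractFamily 𝓕 U S) w ↔
          ∃ v : ↥(Sᶜ), w = some v ∧ D.IsActiveSource 𝓕 (v : V) := by
  cases nonempty_fintype V
  have hne : (D.face (insert U 𝓕)).Nonempty :=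
    MultiDigraph.faceOf_outCut_eq_face_insert (D := D) ▸ hfacet.2.1
  have hd := hbasic.1.insert_dicut hU hne
  obtain ⟨p, hp, hpa⟩ := hbasic.exists_active_mem hU hfacet
  obtain ⟨q, hq, hqa⟩ := hbasic.exists_active_notMem hU hfacet
  refine ⟨hbasic.isContractible hU hfacet hnontriv,
    ⟨hbasic.1.isAffineCritical hbasic.separated, hbasic.1.slack_eq_zero hbasic.separated,
      p, hbasic.1.isSource_of_not_isTightNode hpa, hpa⟩, fun S hSU => ?_⟩
  -- Shrinking one side leaves the active source on the other side as the required witness.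
  obtain ⟨hS, r, hrS, hra⟩ : S.Nonempty ∧ ∃ r ∈ Sᶜ, ¬ D.IsTightNode 𝓕 r := by
    rcases hSU with rfl | rfl
    · exact ⟨hU.1, q, hq, hqa⟩
    · exact ⟨⟨q, hq⟩, p, by simpa using hp, hpa⟩
  have hdS := hd.shrink hU hSU
  have hsep := hbasic.separated_shrink hU hfacet hd hSU hS
  have hactive : ∀ w : MultiDigraph.ShrinkNode S,
      (D.shrink S).IsActiveSource (D.contractFamily 𝓕 U S) w ↔
        ∃ v : ↥(Sᶜ), w = some v ∧ D.IsActiveSource 𝓕 (v : V) := by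
    rintro (_ | v)
    · simp [MultiDigraph.IsActiveSource, hd.isTightNode_shrink_none hU hSU]
    · simp [MultiDigraph.IsActiveSource, hd.isTightNode_shrink_some hU hSU hS,
        hbasic.isTightNode_insert_iff hU hfacet hnontriv, MultiDigraph.isSource_shrink_some]
  cases nonempty_fintype (MultiDigraph.ShrinkNode S)
  exact ⟨⟨hdS.isAffineCritical hsep, hdS.slack_eq_zero hsep, some ⟨r, hrS⟩,
    (hactive _).2 ⟨_, rfl, hbasic.1.isSource_of_not_isTightNode hra, hra⟩⟩, hactive⟩
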